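/- Let $\mathcal G\subset \mathbb N^{\mathbb N\times\mathbb N}\times\mathbb N^{\mathbb N}\times\mathbb N$ be the space of enumerated groups, that is, of all triples (multiplication, inversion, identity) that make the set $\mathbb N$ a group, with the topology induced by the product of the discrete topologies, and let $\mathcal G_{\mathrm{tf}}\subset\mathcal G$ be the (Polish) subspace of torsion-free groups. Definitions. Write $[x,y]$ for the commutator and $C_G(S)$ for the centralizer of $S$ in $G$. For a group $\Gamma$ of homeomorphisms of a space $X$ and an open $U\subseteq X$, let $\Gamma_U$ be the group of all elements of $\Gamma$ that fix every point outside $U$. The group $\Gamma$ is *locally moving* if $\Gamma_U\neq 1$ for every nonempty open $U$, and *locally dense* if for every open $U$ and every $p\in U$ the closure of $\Gamma_U\cdot p$ has nonempty interior. A group is a *Rubin group* if it acts faithfully by homeomorphisms, with locally dense image, on some nonempty locally compact Hausdorff space without isolated points. It is a *weakly Rubin group* if it admits a homomorphism to $\mathrm{Homeo}(X)$ with locally moving image, for some Hausdorff space $X$ with at least two points. In a group $G$, an element $g$ is *algebraically disjoint from* $f$ if for every $h\in G$ with $[f,h]\neq 1$ there are $a,b\in C_G(g)$ with $1\neq[a,[b,h]]\in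 C_G(g)$. Put $S_f=\{g^{12} : g\in G \text{ algebraically disjoint from } f\}$. The *Rubin poset* $\mathcal P(G)$ is the set of all subgroups $C_G(S_{f_1})\cap\dots\cap C_G(S_{f_n})$ with $n\ge 1$ and $f_1,\dots,f_n\in G$, ordered by inclusion. Theorem. There is a comeager subset $\mathcal X\subseteq\mathcal G_{\mathrm{tf}}$ such that every $G\in\mathcal X$ has the following properties. 1. No quotient of $G$ is a Rubin group or a weakly Rubin group. Also, for every non-trivial homomorphism from $G$ to $\mathrm{Homeo}(X)$ with $X$ a Hausdorff space, the image is not locally moving. 2. The Rubin poset $\mathcal P(G)$ is equal to the set of all cyclic subgroups of $G$ (including the trivial one), ordered by inclusion. It contains a bi-infinite chain, i.e. a strictly increasing family indexed by $\mathbb Z$, and an infinite antichain. 3. For all non-trivial $f,g\in G$, the elements $f$ and $g$ commute if and only if $g$ is algebraically disjoint from $f$. -/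

import Mathlib

open scoped commutatorElement

/-! ### Groups of homeomorphisms -/

section Actions

variable {X : Type*} [TopologicalSpace X]

/-- The rigid stabilizer of `U` in a group `Γ` of homeomorphisms of `X`: the elements of `Γ`
that restrict to the identity outside of `U`. -/
def rigidStabilizer (Γ : Subgroup (X ≃ₜ X)) (U : Set X) : Subgroup (X ≃ₜ X) where
  carrier := {γ | γ ∈ Γ ∧ ∀ x, x ∉ U → γ x = x}
  one_mem' := ⟨Γ.one_mem, fun _ _ => rfl⟩
  mul_mem' := by
    rintro a b ⟨ha, ha'⟩ ⟨hb, hb'⟩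
    refine ⟨Γ.mul_mem ha hb, fun x hx => ?_⟩
    change a (b x) = x
    rw [hb' x hx, ha' x hx]
  inv_mem' := by
    rintro a ⟨ha, ha'⟩
    refine ⟨Γ.inv_mem ha, fun x hx => ?_⟩
    change a.symm x = x
    rw [Homeomorph.symm_apply_eq, ha' x hx]

/-- `Γ` is locally dense: for every open `U` and every `p ∈ U`, the closure of the orbit of `p`
under the rigid stabilizer of `U` has nonempty interior. -/
def IsLocallyDense (Γ : Subgroup (X ≃ₜ X)) : Prop :=
  ∀ U : Set X, IsOpen U → ∀ p ∈ U,
    (interior (closure {q : X | ∃ γ ∈ rigidStabilizer Γ U, γ p = q})).Nonempty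

/-- `Γ` is locally moving: every nonempty open set has a non-trivial rigid stabilizer. -/
def IsLocallyMoving (Γ : Subgroup (X ≃ₜ X)) : Prop :=
  ∀ U : Set X, IsOpen U → U.Nonempty → rigidStabilizer Γ U ≠ ⊥

end Actions

/-- `Q` is a Rubin group: it acts faithfully and locally densely on a (nonempty) locally compact
Hausdorff space without isolated points. -/
def IsRubinGroup.{u, v} (Q : Type v) [Group Q] : Prop :=
  ∃ (X : Type u) (_ : TopologicalSpace X),
    Nonempty X ∧ T2Space X ∧ LocallyCompactSpace X ∧ (∀ x : X, ¬ IsOpen ({x} : Set X)) ∧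
      ∃ φ : Q →* (X ≃ₜ X), Function.Injective φ ∧ IsLocallyDense φ.range

/-- `Q` is a weakly Rubin group: some homomorphism from `Q` to the homeomorphism group of a
Hausdorff space with at least two points has locally moving image. -/
def IsWeaklyRubinGroup.{u, v} (Q : Type v) [Group Q] : Prop :=
  ∃ (X : Type u) (_ : TopologicalSpace X),
    Nontrivial X ∧ T2Space X ∧ ∃ φ : Q →* (X ≃ₜ X), IsLocallyMoving φ.range

/-! ### Algebraic disjointness and the Rubin poset -/

section Disjointness

variable {G : Type*} [Group G]

/-- `g` is algebraically disjoint from `f`. -/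
def AlgebraicallyDisjointFrom (g f : G) : Prop :=
  ∀ h : G, ⁅f, h⁆ ≠ 1 →
    ∃ a ∈ Subgroup.centralizer {g}, ∃ b ∈ Subgroup.centralizer {g},
      ⁅a, ⁅b, h⁆⁆ ≠ 1 ∧ ⁅a, ⁅b, h⁆⁆ ∈ Subgroup.centralizer {g}

/-- The set `S_f` of the twelfth powers of the elements algebraically disjoint from `f`. -/
def disjointTwelfthPowers (f : G) : Set G :=
  {k | ∃ g : G, AlgebraicallyDisjointFrom g f ∧ k = g ^ 12}

variable (G) in
/-- The Rubin poset of `G`: the set of the finite intersections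
`C_G(S_{f_1}) ∩ ⋯ ∩ C_G(S_{f_n})` with `n ≥ 1`. It is ordered by inclusion, which is the order
it inherits from `Subgroup G`. -/
def rubinPoset : Set (Subgroup G) :=
  {H | ∃ n : ℕ, 1 ≤ n ∧ ∃ f : Fin n → G,
    H = ⨅ i, Subgroup.centralizer (disjointTwelfthPowers (f i))}

end Disjointness

/-! ### The space of enumerated torsion-free groups -/

/-- A multiplication, an inversion and an identity element on `ℕ`, with the product topology of
discrete spaces. -/
abbrev GroupTable : Type := (ℕ × ℕ → ℕ) × (ℕ → ℕ) × ℕ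

/-- The group axioms. -/
def GroupTable.IsGroup (t : GroupTable) : Prop :=
  (∀ x y z, t.1 (t.1 (x, y), z) = t.1 (x, t.1 (y, z))) ∧
  (∀ x, t.1 (t.2.2, x) = x ∧ t.1 (x, t.2.2) = x) ∧
  (∀ x, t.1 (t.2.1 x, x) = t.2.2 ∧ t.1 (x, t.2.1 x) = t.2.2)

/-- The space of enumerated groups, with the subspace topology. -/
abbrev EnumeratedGroup : Type := {t : GroupTable // t.IsGroup}

/-- The underlying set `ℕ` of an enumerated group. -/
def EnumeratedGroup.Carrier (_ : EnumeratedGroup) : Type := ℕ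

instance EnumeratedGroup.instGroup (t : EnumeratedGroup) : Group t.Carrier where
  mul x y := t.1.1 ((x, y) : ℕ × ℕ)
  mul_assoc x y z := t.2.1 x y z
  one := t.1.2.2
  one_mul x := (t.2.2.1 x).1
  mul_one x := (t.2.2.1 x).2
  inv x := t.1.2.1 x
  inv_mul_cancel x := (t.2.2.2 x).1

/-- The space of enumerated torsion-free groups, with the subspace topology. -/
abbrev EnumeratedTorsionFreeGroup : Type :=
  {t : EnumeratedGroup // ∀ g : t.Carrier, g ≠ 1 → ∀ n : ℕ, 1 ≤ n → g ^ n ≠ 1}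

/-- The group that a point of the space of enumerated torsion-free groups stands for. -/
abbrev EnumeratedTorsionFreeGroup.toGroup (t : EnumeratedTorsionFreeGroup) : Type :=
  EnumeratedGroup.Carrier t.1

universe u

/-! A comeager set of torsion-free groups behaves like existentially closed ones. If an open
condition on finitely many elements can always be forced in a countable torsion-free extension, it
holds on a dense open set (`mem_residual_of_extension`), and countably many such conditions hold
simultaneously on a comeager set. Three families suffice (`IsGenericTorsionFree`).

HNN extensions make any two nontrivial elements conjugate. Wreath products over `G ⧸ C` supply an
element that commutes with the members of `C` and with no other element of `G`. One of them, over `C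
= ⟨f⟩`, separates any `k ∉ ⟨f⟩` from `f`; two in succession give, for `h ∉ ⟨g⟩`, elements `a`, `b`
centralizing `g` such that `⁅a, ⁅b, h⁆⁆` is nontrivial and centralizes `g`.

Hence algebraic disjointness is commutation, and `C_G(S_f) = ⟨f⟩`. A faithful locally moving action
would contain some `h ≠ 1` supported in an open set `U` that `g, ..., g ^ 4` move off itself. The
commutator above would then commute with `g` while supported in four translates of `U`, against the
pigeonhole principle. Conjugacy makes the group simple, which covers all other homomorphisms and
quotients, and provides the square roots for the bi-infinite chain. -/

/-- Every nontrivial element has infinite order. -/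
def HasNoTorsion (G : Type*) [Group G] : Prop :=
  ∀ g : G, g ≠ 1 → ∀ n : ℕ, 1 ≤ n → g ^ n ≠ 1

theorem HasNoTorsion.eq_one {G : Type*} [Group G] (h : HasNoTorsion G) {g : G} {n : ℕ}
    (hn : 1 ≤ n) (hg : g ^ n = 1) : g = 1 :=
  by_contra fun h1 => h g h1 n hn hg

/-! ### HNN extensions of torsion-free groups -/

namespace HNNExtension

variable {G : Type*} [Group G] {A B : Subgroup G} (φ : A ≃* B)

theorem t_zpow_mul_of_mul_t_zpow_neg (u : ℤˣ) (a : toSubgroup A B u) :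
    (t ^ (u : ℤ) * of (a : G) * t ^ ((-u : ℤˣ) : ℤ) : HNNExtension G A B φ) =
      of (toSubgroupEquiv φ u a : G) := by
  rcases Int.units_eq_one_or u with rfl | rfl
  · simp only [Units.val_one, Units.val_neg, zpow_one, zpow_neg]
    exact (equiv_eq_conj (φ := φ) a).symm
  · simp only [Units.val_one, Units.val_neg, zpow_one, zpow_neg, neg_neg]
    exact (equiv_symm_eq_conj (φ := φ) a).symm

/-- The product of a list of pairs `(u, g)`, each standing for `t ^ u * g`. -/
def listProd (l : List (ℤˣ × G)) : HNNExtension G A B φ :=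
  (l.map fun x => t ^ (x.1 : ℤ) * of x.2).prod

@[simp]
theorem listProd_nil : listProd φ [] = 1 := rfl

@[simp]
theorem listProd_cons (x : ℤˣ × G) (l : List (ℤˣ × G)) :
    listProd φ (x :: l) = t ^ (x.1 : ℤ) * of x.2 * listProd φ l := by
  simp [listProd]

@[simp]
theorem listProd_append (l l' : List (ℤˣ × G)) :
    listProd φ (l ++ l') = listProd φ l * listProd φ l' := by
  simp [listProd]

theorem listProd_flatten_replicate (m : ℕ) (l : List (ℤˣ × G)) :
    listProd φ (List.replicate m l).flatten = listProd φ l ^ m := by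
  induction m with
  | zero => simp
  | succ m ih => simp [List.replicate_succ, ih, pow_succ']

/-- Britton's lemma: the chain condition says that the word has no pinch. -/
theorem listProd_ne_one {l : List (ℤˣ × G)} (hl : l ≠ [])
    (hc : l.IsChain fun a b => a.2 ∈ toSubgroup A B a.1 → a.1 = b.1) : listProd φ l ≠ 1 := by
  intro h
  refine hl (ReducedWord.toList_eq_nil_of_mem_of_range φ ⟨1, l, hc⟩ ⟨1, ?_⟩)
  simpa [NormalWord.ReducedWord.prod, listProd] using h.symm

/-- Every element is conjugate to a base element or to a cyclically reduced word. Powers of the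
latter are again reduced, hence nontrivial. A word that is not cyclically reduced is conjugate to
one shorter by two letters. -/
theorem eq_one_of_pow_eq_one (hG : HasNoTorsion G) {m : ℕ} (hm : 1 ≤ m) (n : ℕ) :
    ∀ (g : G) (l : List (ℤˣ × G)), l.length = n →
      l.IsChain (fun a b => a.2 ∈ toSubgroup A B a.1 → a.1 = b.1) →
      (of g * listProd φ l) ^ m = 1 → of g * listProd φ l = 1 := by
  induction n using Nat.strong_induction_on with
  | _ n ih =>
  intro g l hn hc hx
  rcases List.eq_nil_or_concat l with rfl | ⟨l, ⟨u, h⟩, rfl⟩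
  · simp only [listProd_nil, mul_one, ← map_pow] at hx ⊢
    rw [hG.eq_one hm (of_injective φ (hx.trans (map_one _).symm)), map_one]
  rw [List.concat_eq_append] at *
  -- The chain condition reads only the sign of the last letter, so its coefficient can absorb `g`,
  -- at the cost of a conjugation.
  have hc' : (l ++ [(u, h * g)]).IsChain fun a b => a.2 ∈ toSubgroup A B a.1 → a.1 = b.1 := by
    rw [List.isChain_append] at hc ⊢
    refine ⟨hc.1, List.isChain_singleton _, fun x hx y hy => ?_⟩
    simp only [List.head?_cons, Option.mem_def, Option.some.injEq] at hy
    subst hy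
    exact hc.2.2 x hx (u, h) (by simp)
  have hconj : of g * listProd φ (l ++ [(u, h)]) =
      of g * listProd φ (l ++ [(u, h * g)]) * (of g)⁻¹ := by
    simp [mul_assoc]
  rw [hconj, conj_pow, conj_eq_one_iff] at hx
  rw [hconj, conj_eq_one_iff]
  -- Is there no pinch where the end of the word meets its beginning?
  by_cases hcyc : ∀ y ∈ (l ++ [(u, h * g)]).head?, h * g ∈ toSubgroup A B u → u = y.1
  · refine absurd hx ?_
    rw [← listProd_flatten_replicate]
    refine listProd_ne_one φ (by simp; omega) ?_
    rw [List.isChain_flatten (by simp)]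
    refine ⟨fun l' hl' => by rwa [(List.mem_replicate.1 hl').2], ?_⟩
    refine List.isChain_replicate_of_rel m ?_
    intro x hx y hy
    simp only [List.getLast?_append, List.getLast?_singleton, Option.some_or, Option.mem_def,
      Option.some.injEq] at hx
    subst hx
    exact hcyc y hy
  · push Not at hcyc
    obtain ⟨⟨v, k⟩, hy, hmem, huv⟩ := hcyc
    cases l with
    | nil => simp at hy; exact absurd hy.1 huv
    | cons y l =>
      simp at hy
      subst hy
      have hv : v = -u := by
        rcases Int.units_eq_one_or u with rfl | rfl <;>
          rcases Int.units_eq_one_or v with rfl | rfl <;> simp_all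
      subst hv
      -- Rotating the last letter to the front creates the pinch `t ^ u * (h * g) * t ^ (-u)`, which
      -- collapses into the base group.
      have hrot : listProd φ ((-u, k) :: l ++ [(u, h * g)]) =
          (t ^ (u : ℤ) * of (h * g))⁻¹ *
            (of ((toSubgroupEquiv φ u ⟨h * g, hmem⟩ : G) * k) * listProd φ l) *
            (t ^ (u : ℤ) * of (h * g))⁻¹⁻¹ := by
        rw [map_mul of _ k, ← t_zpow_mul_of_mul_t_zpow_neg]
        simp only [List.cons_append, listProd_cons, listProd_append, listProd_nil]
        group
      rw [hrot, conj_pow, conj_eq_one_iff] at hx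
      rw [hrot, conj_eq_one_iff]
      refine ih l.length (by simp at hn; omega) _ _ rfl ?_ hx
      rw [List.cons_append] at hc
      exact (List.isChain_append.1 hc.tail).1

theorem exists_eq_of_mul_listProd (x : HNNExtension G A B φ) :
    ∃ (g : G) (l : List (ℤˣ × G)),
      l.IsChain (fun a b => a.2 ∈ toSubgroup A B a.1 → a.1 = b.1) ∧ x = of g * listProd φ l := by
  obtain ⟨d⟩ := NormalWord.TransversalPair.nonempty G A B
  obtain ⟨w, rfl⟩ := (NormalWord.equiv φ d).symm.surjective x
  exact ⟨w.head, w.toList, w.chain, rfl⟩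

theorem hasNoTorsion (hG : HasNoTorsion G) : HasNoTorsion (HNNExtension G A B φ) := by
  intro x hx m hm h
  obtain ⟨g, l, hl, rfl⟩ := exists_eq_of_mul_listProd φ x
  exact hx (eq_one_of_pow_eq_one φ hG hm _ g l rfl hl h)

theorem countable [Countable G] : Countable (HNNExtension G A B φ) := by
  have : Function.Surjective fun p : G × List (ℤˣ × G) => of (φ := φ) p.1 * listProd φ p.2 :=
    fun x => let ⟨g, l, _, h⟩ := exists_eq_of_mul_listProd φ x; ⟨(g, l), h.symm⟩
  exact this.countable

end HNNExtension

theorem HasNoTorsion.zpow_eq_one_iff {G : Type*} [Group G] (h : HasNoTorsion G) {g : G}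
    (hg : g ≠ 1) {n : ℤ} : g ^ n = 1 ↔ n = 0 := by
  have ho : ¬ IsOfFinOrder g := by
    rw [isOfFinOrder_iff_pow_eq_one]
    rintro ⟨m, hm, hm'⟩
    exact h g hg m hm hm'
  rw [← zpow_zero g]
  exact (injective_zpow_iff_not_isOfFinOrder.2 ho).eq_iff

/-- Any two nontrivial elements of a torsion-free group become conjugate in a torsion-free
extension. -/
theorem exists_extension_conj {G : Type} [Group G] [Countable G] (hG : HasNoTorsion G) {g h : G}
    (hg : g ≠ 1) (hh : h ≠ 1) :
    ∃ (K : Type) (_ : Group K) (_ : Countable K) (ι : G →* K), HasNoTorsion K ∧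
      Function.Injective ι ∧ ∃ s : K, s * ι g * s⁻¹ = ι h := by
  have key (x : G) (hx : x ≠ 1) : Function.Injective (zpowersHom G x) := by
    rw [injective_iff_map_eq_one]
    intro n hn
    exact (hG.zpow_eq_one_iff hx).1 hn
  -- Both cyclic subgroups are infinite, so `g ↦ h` defines an isomorphism between them; the stable
  -- letter realizes it by conjugation.
  let φ := (MonoidHom.ofInjective (key g hg)).symm.trans (MonoidHom.ofInjective (key h hh))
  refine ⟨HNNExtension G _ _ φ, inferInstance, HNNExtension.countable φ, HNNExtension.of,
    HNNExtension.hasNoTorsion φ hG, HNNExtension.of_injective φ, HNNExtension.t, ?_⟩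
  have h1 := HNNExtension.equiv_eq_conj (φ := φ)
    (MonoidHom.ofInjective (key g hg) (Multiplicative.ofAdd 1))
  have h2 : φ (MonoidHom.ofInjective (key g hg) (Multiplicative.ofAdd 1)) =
      MonoidHom.ofInjective (key h hh) (Multiplicative.ofAdd 1) := by
    simp [φ]
  rw [h2, MonoidHom.ofInjective_apply, MonoidHom.ofInjective_apply] at h1
  simpa using h1.symm

/-! ### Wreath products over coset spaces and prescribed centralizers -/

section CosetWreath

variable {G : Type*} [Group G]

/-- The permutation action of `G` on the free abelian group on `G ⧸ C`. -/
noncomputable def cosetAction (C : Subgroup G) : G →* MulAut (Multiplicative (G ⧸ C →₀ ℤ)) where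
  toFun x := AddEquiv.toMultiplicative (Finsupp.domCongr (MulAction.toPerm x))
  map_one' := by
    ext n q
    change n.toAdd ((1 : G)⁻¹ • q) = n.toAdd q
    simp
  map_mul' x y := by
    ext n q
    change n.toAdd ((x * y)⁻¹ • q) = n.toAdd (y⁻¹ • x⁻¹ • q)
    rw [mul_inv_rev, mul_smul]

theorem toAdd_cosetAction_apply (C : Subgroup G) (x : G) (n : Multiplicative (G ⧸ C →₀ ℤ))
    (q : G ⧸ C) : (cosetAction C x n).toAdd q = n.toAdd (x⁻¹ • q) := rfl

/-- The restricted permutational wreath product of `ℤ` and `G` over `G ⧸ C`. -/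
abbrev CosetWreath (C : Subgroup G) : Type _ :=
  Multiplicative (G ⧸ C →₀ ℤ) ⋊[cosetAction C] G

namespace CosetWreath

variable (C : Subgroup G)

instance [Countable G] : Countable (CosetWreath C) := by
  have : Countable (G ⧸ C) := Quotient.countable
  have : Countable (Multiplicative (G ⧸ C →₀ ℤ)) := inferInstanceAs (Countable (G ⧸ C →₀ ℤ))
  exact SemidirectProduct.equivProd.injective.countable

/-- The quotient `G` is torsion-free, so a torsion element lies in the base, which is free abelian.
-/
theorem hasNoTorsion (hG : HasNoTorsion G) : HasNoTorsion (CosetWreath C) := by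
  intro x hx m hm h
  have hr : x.right = 1 := hG.eq_one hm <| by
    rw [← SemidirectProduct.rightHom_eq_right, ← map_pow, h, map_one]
  obtain ⟨n, rfl⟩ : ∃ n, SemidirectProduct.inl n = x :=
    ⟨x.left, by ext <;> simp [hr]⟩
  rw [← map_pow, ← map_one SemidirectProduct.inl, SemidirectProduct.inl_inj] at h
  refine hx ?_
  have h2 : m • n.toAdd = 0 := h
  have h3 : n.toAdd = 0 := (smul_eq_zero.1 h2).resolve_left (by omega)
  rw [show n = 1 from h3, map_one]

/-- The basis element at the coset `C`. -/
noncomputable def gen : CosetWreath C :=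
  SemidirectProduct.inl (Multiplicative.ofAdd (Finsupp.single ((1 : G) : G ⧸ C) 1))

theorem cosetAction_ofAdd_single (x : G) (q : G ⧸ C) (r : ℤ) :
    cosetAction C x (Multiplicative.ofAdd (Finsupp.single q r)) =
      Multiplicative.ofAdd (Finsupp.single (x • q) r) :=
  congrArg Multiplicative.ofAdd (Finsupp.equivMapDomain_single (MulAction.toPerm x) q r)

/-- Conjugation by `x` carries the basis element at `C` to the one at `x • C`. -/
theorem commute_gen_pow_iff {m : ℕ} (hm : m ≠ 0) (x : G) :
    Commute (gen C ^ m) (SemidirectProduct.inr x) ↔ x ∈ C := by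
  rw [commute_iff_eq, eq_comm, ← mul_inv_eq_iff_eq_mul, gen, ← map_pow, ← map_inv,
    ← SemidirectProduct.inl_aut, SemidirectProduct.inl_inj, ← ofAdd_nsmul, Finsupp.smul_single,
    cosetAction_ofAdd_single, Multiplicative.ofAdd.injective.eq_iff,
    Finsupp.single_left_inj (by simpa using hm), MulAction.Quotient.smul_coe, eq_comm,
    QuotientGroup.eq]
  simp

theorem commute_gen_iff (x : G) : Commute (gen C) (SemidirectProduct.inr x) ↔ x ∈ C := by
  simpa using commute_gen_pow_iff C one_ne_zero x

/-- The elements of `CosetWreath C` acting through `C` whose coefficient at `C` vanishes. -/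
def vanishing : Subgroup (CosetWreath C) where
  carrier := {x | x.left.toAdd ((1 : G) : G ⧸ C) = 0 ∧ x.right ∈ C}
  one_mem' := ⟨rfl, C.one_mem⟩
  mul_mem' := by
    rintro x y ⟨hx, hx'⟩ ⟨hy, hy'⟩
    refine ⟨?_, C.mul_mem hx' hy'⟩
    have h : x.right⁻¹ • ((1 : G) : G ⧸ C) = ((1 : G) : G ⧸ C) := by
      rw [MulAction.Quotient.smul_coe, QuotientGroup.eq]
      simpa using hx'
    rw [SemidirectProduct.mul_left, toAdd_mul, Finsupp.add_apply, toAdd_cosetAction_apply, h, hx,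
      hy, add_zero]
  inv_mem' := by
    rintro x ⟨hx, hx'⟩
    refine ⟨?_, C.inv_mem hx'⟩
    have h : x.right • ((1 : G) : G ⧸ C) = ((1 : G) : G ⧸ C) := by
      rw [MulAction.Quotient.smul_coe, QuotientGroup.eq]
      simpa using hx'
    rw [SemidirectProduct.inv_left, toAdd_cosetAction_apply, inv_inv, h, toAdd_inv,
      Finsupp.neg_apply, hx, neg_zero]

theorem commutator_gen_inr (h : G) :
    ⁅gen C, SemidirectProduct.inr h⁆ = (SemidirectProduct.inl (Multiplicative.ofAdd
      (Finsupp.single ((1 : G) : G ⧸ C) 1 - Finsupp.single (h : G ⧸ C) 1)) : CosetWreath C) := by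
  rw [commutatorElement_def, gen, mul_assoc, mul_assoc, ← mul_assoc (SemidirectProduct.inr h),
    ← map_inv SemidirectProduct.inl, ← map_inv SemidirectProduct.inr,
    ← SemidirectProduct.inl_aut, ← map_mul, ← ofAdd_neg,
    ← Finsupp.single_neg, cosetAction_ofAdd_single, ← ofAdd_add, Finsupp.single_neg,
    sub_eq_add_neg, MulAction.Quotient.smul_coe, smul_eq_mul, mul_one]

/-- The commutator of `gen C` and `h ∉ C` does not lie in the subgroup generated by `g ∈ C`
and the conjugate of `g` by that commutator. -/
theorem commutator_gen_inr_notMem {g h : G} (hg : g ∈ C) (hh : h ∉ C) {w : CosetWreath C}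
    (hw : w = ⁅gen C, SemidirectProduct.inr h⁆) :
    w ∉ Subgroup.closure {SemidirectProduct.inr g, w⁻¹ * SemidirectProduct.inr g * w} := by
  have hne : (h : G ⧸ C) ≠ ((1 : G) : G ⧸ C) := by
    rw [Ne, eq_comm, QuotientGroup.eq]
    simpa using hh
  have hsmul : g⁻¹ • ((1 : G) : G ⧸ C) = ((1 : G) : G ⧸ C) := by
    rw [MulAction.Quotient.smul_coe, QuotientGroup.eq]
    simpa using hg
  have hl : w.left.toAdd ((1 : G) : G ⧸ C) = 1 := by
    rw [hw, commutator_gen_inr]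
    rw [SemidirectProduct.left_inl, toAdd_ofAdd, Finsupp.sub_apply, Finsupp.single_eq_same,
      Finsupp.single_eq_of_ne hne.symm, sub_zero]
  have hr : w.right = 1 := by
    rw [hw, commutator_gen_inr, SemidirectProduct.right_inl]
  have hle : Subgroup.closure {SemidirectProduct.inr g, w⁻¹ * SemidirectProduct.inr g * w} ≤
      vanishing C := by
    rw [Subgroup.closure_le]
    rintro _ (rfl | rfl)
    · exact ⟨rfl, hg⟩
    -- In the coefficient at `C`, conjugating by `w` contributes `-1` and `+1`, which cancel because
    -- `g` fixes the coset `C`. The coefficient of `w` itself is `1`.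
    · refine ⟨?_, by simpa [hr] using hg⟩
      simp [hr, toAdd_cosetAction_apply, hsmul, hl]
  intro hmem
  exact one_ne_zero (hl.symm.trans (hle hmem).1)

end CosetWreath

end CosetWreath

/-- For `k` outside of `C` there is a torsion-free extension with an element that centralizes
`C` but whose powers do not commute with `k`. -/
theorem exists_extension_centralizing {G : Type} [Group G] [Countable G] (hG : HasNoTorsion G)
    {f k : G} (hk : k ∉ Subgroup.zpowers f) {m : ℕ} (hm : m ≠ 0) :
    ∃ (K : Type) (_ : Group K) (_ : Countable K) (ι : G →* K), HasNoTorsion K ∧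
      Function.Injective ι ∧ ∃ s : K, Commute s (ι f) ∧ ¬ Commute (s ^ m) (ι k) :=
  ⟨CosetWreath (Subgroup.zpowers f), inferInstance, inferInstance, SemidirectProduct.inr,
    CosetWreath.hasNoTorsion _ hG, SemidirectProduct.inr_injective, CosetWreath.gen _,
    (CosetWreath.commute_gen_iff _ f).2 (Subgroup.mem_zpowers f),
    fun h => hk ((CosetWreath.commute_gen_pow_iff _ hm k).1 h)⟩

/-- If `a` commutes with `g` and with `w⁻¹ * g * w`, then `⁅a, w⁆` commutes with `g`. -/
theorem Commute.commutator_of_conj {G : Type*} [Group G] {a g w : G} (h : Commute a g)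
    (h' : Commute a (w⁻¹ * g * w)) : Commute g ⁅a, w⁆ := by
  have h2 : Commute (w * a⁻¹ * w⁻¹) g := by
    have := (Commute.conj_iff w).2 h'.inv_left
    simpa [mul_assoc] using this
  have := (h.symm.mul_right h2.symm)
  simpa [commutatorElement_def, mul_assoc] using this

/-- The generator over `⟨g⟩` serves as `b`; put `w = ⁅b, h⁆`. The generator over `A = ⟨g, w⁻¹ * g *
w⟩` serves as `a`: it commutes with both generators of `A`, so `⁅a, w⁆` commutes with `g`, and it
does not commute with `w` because `w ∉ A`. -/
theorem exists_extension_commutator {G : Type} [Group G] [Countable G] (hG : HasNoTorsion G)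
    {g h : G} (hh : h ∉ Subgroup.zpowers g) :
    ∃ (K : Type) (_ : Group K) (_ : Countable K) (ι : G →* K), HasNoTorsion K ∧
      Function.Injective ι ∧ ∃ a b : K, Commute a (ι g) ∧ Commute b (ι g) ∧
        ⁅a, ⁅b, ι h⁆⁆ ≠ 1 ∧ Commute (ι g) ⁅a, ⁅b, ι h⁆⁆ := by
  let C := Subgroup.zpowers g
  let ι₁ : G →* CosetWreath C := SemidirectProduct.inr
  let w : CosetWreath C := ⁅CosetWreath.gen C, ι₁ h⁆
  let A : Subgroup (CosetWreath C) := Subgroup.closure {ι₁ g, w⁻¹ * ι₁ g * w}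
  let ι₂ : CosetWreath C →* CosetWreath A := SemidirectProduct.inr
  have hgC : g ∈ C := Subgroup.mem_zpowers g
  have ha (x : CosetWreath C) : Commute (CosetWreath.gen A) (ι₂ x) ↔ x ∈ A :=
    CosetWreath.commute_gen_iff A x
  have h1 : Commute (CosetWreath.gen A) (ι₂ (ι₁ g)) :=
    (ha _).2 (Subgroup.subset_closure (by simp))
  have h2 : Commute (CosetWreath.gen A) ((ι₂ w)⁻¹ * ι₂ (ι₁ g) * ι₂ w) := by
    rw [← map_inv, ← map_mul, ← map_mul]
    exact (ha _).2 (Subgroup.subset_closure (by simp))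
  have h3 : ⁅ι₂ (CosetWreath.gen C), ι₂ (ι₁ h)⁆ = ι₂ w := (map_commutatorElement ι₂ _ _).symm
  refine ⟨CosetWreath A, inferInstance, inferInstance, ι₂.comp ι₁,
    CosetWreath.hasNoTorsion _ (CosetWreath.hasNoTorsion _ hG),
    SemidirectProduct.inr_injective.comp SemidirectProduct.inr_injective,
    CosetWreath.gen A, ι₂ (CosetWreath.gen C), h1,
    ((CosetWreath.commute_gen_iff C g).2 hgC).map ι₂, ?_, ?_⟩
  · rw [MonoidHom.comp_apply, h3, Ne, commutatorElement_eq_one_iff_commute, ha]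
    exact CosetWreath.commutator_gen_inr_notMem C hgC hh rfl
  · rw [MonoidHom.comp_apply, MonoidHom.comp_apply, h3]
    exact h1.commutator_of_conj h2

/-! ### Topology of enumerated groups and density by extension -/

/-- An injection of `ℕ` into a countable set agrees on any finite set with a bijection. -/
theorem exists_equiv_eqOn_finset {K : Type*} [Countable K] {ι : ℕ → K}
    (hι : Function.Injective ι) (F : Finset ℕ) : ∃ e : ℕ ≃ K, ∀ x ∈ F, e x = ι x := by
  classical
  have : Infinite K := Infinite.of_injective ι hι
  let s : Set ℕ := F
  have h1 : Infinite ↥sᶜ := F.finite_toSet.infinite_compl.to_subtype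
  have h2 : Infinite ↥(ι '' s)ᶜ := (F.finite_toSet.image ι).infinite_compl.to_subtype
  -- Off the finite sets both complements are countably infinite, so any bijection between them
  -- completes `ι`.
  obtain ⟨e⟩ := nonempty_equiv_of_countable (α := ↥sᶜ) (β := ↥(ι '' s)ᶜ)
  refine ⟨(Equiv.Set.sumCompl s).symm.trans
    ((Equiv.sumCongr (Equiv.Set.image ι s hι) e).trans (Equiv.Set.sumCompl (ι '' s))), ?_⟩
  intro x hx
  simp [Equiv.Set.sumCompl_symm_apply_of_mem (show x ∈ s from hx)]

theorem exists_finset_of_mem_nhds {α β : Type*} [TopologicalSpace β] [DiscreteTopology β]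
    {f : α → β} {s : Set (α → β)} (hs : s ∈ nhds f) :
    ∃ I : Finset α, ∀ f' : α → β, (∀ i ∈ I, f' i = f i) → f' ∈ s := by
  rw [nhds_pi, Filter.mem_pi] at hs
  obtain ⟨I, hI, u, hu, hs⟩ := hs
  refine ⟨hI.toFinset, fun f' hf' => hs fun i hi => ?_⟩
  rw [hf' i (hI.mem_toFinset.2 hi)]
  exact mem_of_mem_nhds (hu i)

theorem continuous_apply_of_discrete {T α β : Type*} [TopologicalSpace T] [TopologicalSpace α]
    [DiscreteTopology α] [TopologicalSpace β] {f : T → α → β} {u : T → α} (hf : Continuous f)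
    (hu : Continuous u) : Continuous fun x => f x (u x) := by
  rw [continuous_iff_continuousAt]
  intro x
  refine ((continuous_apply (u x)).comp hf).continuousAt.congr ?_
  filter_upwards [(hu.isOpen_preimage {u x} (isOpen_discrete _)).mem_nhds rfl] with y hy
  have : u y = u x := hy
  simp [this]

namespace EnumeratedTorsionFreeGroup

instance (t : EnumeratedTorsionFreeGroup) : Countable t.toGroup :=
  inferInstanceAs (Countable ℕ)

instance (t : EnumeratedTorsionFreeGroup) : Infinite t.toGroup :=
  inferInstanceAs (Infinite ℕ)

/-- The group element with a given number. -/
def elem (x : ℕ) (t : EnumeratedTorsionFreeGroup) : t.toGroup := x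

theorem exists_finset_forall_mem {t : EnumeratedTorsionFreeGroup}
    {O : Set EnumeratedTorsionFreeGroup} (hO : O ∈ nhds t) :
    ∃ F : Finset ℕ, ∀ t' : EnumeratedTorsionFreeGroup,
      (∀ x ∈ F, ∀ y ∈ F, t'.1.1.1 (x, y) = t.1.1.1 (x, y)) →
      (∀ x ∈ F, t'.1.1.2.1 x = t.1.1.2.1 x) → t'.1.1.2.2 = t.1.1.2.2 → t' ∈ O := by
  classical
  obtain ⟨O₁, hO₁, hO⟩ := mem_nhds_subtype _ _ _ |>.1 hO
  obtain ⟨O₂, hO₂, hO'⟩ := mem_nhds_subtype _ _ _ |>.1 hO₁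
  obtain ⟨U, hU, V, hV, hUV⟩ := mem_nhds_prod_iff.1 hO₂
  obtain ⟨V₁, hV₁, V₂, hV₂, hV⟩ := mem_nhds_prod_iff.1 hV
  obtain ⟨I, hI⟩ := exists_finset_of_mem_nhds hU
  obtain ⟨J, hJ⟩ := exists_finset_of_mem_nhds hV₁
  refine ⟨I.image Prod.fst ∪ I.image Prod.snd ∪ J, fun t' h1 h2 h3 => hO (hO' (hUV ⟨?_, hV ⟨?_, ?_⟩⟩))⟩
  · refine hI _ fun i hi => h1 i.1 ?_ i.2 ?_
    · simp only [Finset.mem_union, Finset.mem_image]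
      exact Or.inl (Or.inl ⟨i, hi, rfl⟩)
    · simp only [Finset.mem_union, Finset.mem_image]
      exact Or.inl (Or.inr ⟨i, hi, rfl⟩)
  · exact hJ _ fun i hi => h2 i (Finset.mem_union_right _ hi)
  · rw [h3]
    exact mem_of_mem_nhds hV₂

/-- The enumerated group obtained by numbering the elements of a torsion-free group. -/
def ofEquiv {K : Type} [Group K] (hK : HasNoTorsion K) (e : ℕ ≃ K) :
    EnumeratedTorsionFreeGroup :=
  let t : EnumeratedGroup :=
    ⟨(fun p => e.symm (e p.1 * e p.2), fun x => e.symm (e x)⁻¹, e.symm 1),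
      fun x y z => by simp [mul_assoc], fun x => by simp, fun x => by simp⟩
  let f : t.Carrier →* K :=
    { toFun := fun x => e x
      map_one' := e.apply_symm_apply 1
      map_mul' := fun x y => e.apply_symm_apply (e x * e y) }
  ⟨t, fun g hg n hn h => hK (f g)
    (fun h1 => hg (e.injective (h1.trans (map_one f).symm))) n hn
    (by rw [← map_pow, h, map_one])⟩

/-- The group `ofEquiv hK e` is isomorphic to `K`. -/
def ofEquivMulEquiv {K : Type} [Group K] (hK : HasNoTorsion K) (e : ℕ ≃ K) :
    (ofEquiv hK e).toGroup ≃* K where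
  toEquiv := e
  map_mul' x y := e.apply_symm_apply (e x * e y)

/-- Every torsion-free extension of `t` has enumerations arbitrarily close to `t`. -/
theorem exists_mem_nhds_mulEquiv {t : EnumeratedTorsionFreeGroup}
    {O : Set EnumeratedTorsionFreeGroup} (hO : O ∈ nhds t) (P : Finset ℕ) {K : Type} [Group K]
    [Countable K] (hK : HasNoTorsion K) (ι : t.toGroup →* K) (hι : Function.Injective ι) :
    ∃ t' ∈ O, ∃ e : t'.toGroup ≃* K, ∀ x ∈ P, e (elem x t') = ι (elem x t) := by
  classical
  obtain ⟨F, hF⟩ := exists_finset_forall_mem hO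
  -- Products, inverses and the identity are included so that the prescribed table entries also keep
  -- their numbers.
  let F' : Finset ℕ := P ∪ F ∪ (F ×ˢ F).image t.1.1.1 ∪ F.image t.1.1.2.1 ∪ {t.1.1.2.2}
  obtain ⟨e, he⟩ := exists_equiv_eqOn_finset (ι := ι) hι F'
  have hsymm : ∀ x ∈ F', ∀ k : K, ι x = k → e.symm k = x := by
    rintro x hx k rfl
    rw [← he x hx, e.symm_apply_apply]
  refine ⟨ofEquiv hK e, hF _ ?_ ?_ ?_, ofEquivMulEquiv hK e, fun x hx => he x (by simp [F', hx])⟩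
  · intro x hx y hy
    change e.symm (e x * e y) = _
    refine hsymm _ ?_ _ ?_
    · simp only [F', Finset.mem_union, Finset.mem_image, Finset.mem_product]
      exact Or.inl (Or.inl (Or.inr ⟨(x, y), ⟨hx, hy⟩, rfl⟩))
    · rw [he x (by simp [F', hx]), he y (by simp [F', hy])]
      exact map_mul ι (elem x t) (elem y t)
  · intro x hx
    change e.symm (e x)⁻¹ = _
    refine hsymm _ ?_ _ ?_
    · simp only [F', Finset.mem_union, Finset.mem_image]
      exact Or.inl (Or.inr ⟨x, hx, rfl⟩)
    · rw [he x (by simp [F', hx])]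
      exact map_inv ι (elem x t)
  · exact hsymm _ (by simp [F']) _ (map_one ι)

/-- The set `P` holds the numbers of the parameters in the condition; they keep their meaning when
the extension is renumbered. -/
theorem mem_residual_of_extension {S : Set EnumeratedTorsionFreeGroup} (hS : IsOpen S)
    (P : Finset ℕ)
    (h : ∀ t ∉ S, ∃ (K : Type) (_ : Group K) (_ : Countable K) (ι : t.toGroup →* K),
      HasNoTorsion K ∧ Function.Injective ι ∧ ∀ t' : EnumeratedTorsionFreeGroup,
        ∀ e : t'.toGroup ≃* K, (∀ x ∈ P, e (elem x t') = ι (elem x t)) → t' ∈ S) :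
    S ∈ residual EnumeratedTorsionFreeGroup := by
  refine residual_of_dense_open hS fun t => mem_closure_iff_nhds.2 fun O hO => ?_
  by_cases ht : t ∈ S
  · exact ⟨t, mem_of_mem_nhds hO, ht⟩
  · obtain ⟨K, _, _, ι, hK, hι, hS⟩ := h t ht
    obtain ⟨t', ht', e, he⟩ := exists_mem_nhds_mulEquiv hO P hK ι hι
    exact ⟨t', ht', hS t' e he⟩

/-- A family of group elements is continuous if so is the family of their numbers. -/
def IsContinuousFamily (u : ∀ t : EnumeratedTorsionFreeGroup, t.toGroup) : Prop :=
  @Continuous EnumeratedTorsionFreeGroup ℕ _ _ u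

namespace IsContinuousFamily

variable {u v : ∀ t : EnumeratedTorsionFreeGroup, t.toGroup}

theorem elem (x : ℕ) : IsContinuousFamily (elem x) :=
  continuous_const

theorem one : IsContinuousFamily fun _ => 1 :=
  (continuous_snd.comp continuous_snd).comp (continuous_subtype_val.comp continuous_subtype_val)

theorem mul (hu : IsContinuousFamily u) (hv : IsContinuousFamily v) :
    IsContinuousFamily fun t => u t * v t :=
  continuous_apply_of_discrete (α := ℕ × ℕ) (β := ℕ)
    (f := fun t : EnumeratedTorsionFreeGroup => t.1.1.1) (u := fun t => (u t, v t))
    (continuous_fst.comp (continuous_subtype_val.comp continuous_subtype_val))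
    (Continuous.prodMk hu hv)

theorem inv (hu : IsContinuousFamily u) : IsContinuousFamily fun t => (u t)⁻¹ :=
  continuous_apply_of_discrete (α := ℕ) (β := ℕ)
    (f := fun t : EnumeratedTorsionFreeGroup => t.1.1.2.1) (u := u)
    ((continuous_fst.comp continuous_snd).comp
      (continuous_subtype_val.comp continuous_subtype_val)) hu

theorem pow (hu : IsContinuousFamily u) (n : ℕ) : IsContinuousFamily fun t => u t ^ n := by
  induction n with
  | zero => simpa only [pow_zero] using one
  | succ n ih => simpa only [pow_succ] using ih.mul hu

theorem zpow (hu : IsContinuousFamily u) (n : ℤ) : IsContinuousFamily fun t => u t ^ n := by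
  cases n with
  | ofNat n => simpa only [Int.ofNat_eq_natCast, zpow_natCast] using hu.pow n
  | negSucc n => simpa only [zpow_negSucc] using (hu.pow (n + 1)).inv

theorem commutatorElement (hu : IsContinuousFamily u) (hv : IsContinuousFamily v) :
    IsContinuousFamily fun t => ⁅u t, v t⁆ :=
  ((hu.mul hv).mul hu.inv).mul hv.inv

theorem isOpen_setOf_eq (hu : IsContinuousFamily u) (hv : IsContinuousFamily v) :
    IsOpen {t | u t = v t} :=
  (isOpen_discrete {p : ℕ × ℕ | p.1 = p.2}).preimage (Continuous.prodMk hu hv)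

theorem isOpen_setOf_ne (hu : IsContinuousFamily u) (hv : IsContinuousFamily v) :
    IsOpen {t | u t ≠ v t} :=
  (isOpen_discrete {p : ℕ × ℕ | p.1 ≠ p.2}).preimage (Continuous.prodMk hu hv)

theorem isOpen_setOf_commute (hu : IsContinuousFamily u) (hv : IsContinuousFamily v) :
    IsOpen {t | Commute (u t) (v t)} :=
  (hu.mul hv).isOpen_setOf_eq (hv.mul hu)

theorem isOpen_setOf_mem_zpowers (hu : IsContinuousFamily u) (hv : IsContinuousFamily v) :
    IsOpen {t | v t ∈ Subgroup.zpowers (u t)} := by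
  simp only [Subgroup.mem_zpowers_iff, Set.ofPred_exists]
  exact isOpen_iUnion fun n => (hu.zpow n).isOpen_setOf_eq hv

end IsContinuousFamily

theorem isOpen_setOf_exists {p : ∀ t : EnumeratedTorsionFreeGroup, t.toGroup → Prop}
    (hp : ∀ x, IsOpen {t | p t (elem x t)}) : IsOpen {t | ∃ x, p t x} := by
  have h : {t | ∃ x, p t x} = ⋃ x, {t | p t (elem x t)} := by
    ext t
    simp only [Set.mem_ofPred_eq, Set.mem_iUnion]
    exact Iff.rfl
  exact h ▸ isOpen_iUnion hp

end EnumeratedTorsionFreeGroup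

/-! ### The three generic properties -/

/-- The properties of a generic torsion-free group that decide its commutation relations. -/
structure IsGenericTorsionFree (G : Type*) [Group G] : Prop where
  hasNoTorsion : HasNoTorsion G
  exists_centralizing (f k : G) : k ∈ Subgroup.zpowers f ∨
    ∃ s, Commute s f ∧ ¬ Commute (s ^ 12) k
  exists_commutator (g h : G) : h ∈ Subgroup.zpowers g ∨
    ∃ a b, Commute a g ∧ Commute b g ∧ ⁅a, ⁅b, h⁆⁆ ≠ 1 ∧ Commute g ⁅a, ⁅b, h⁆⁆
  exists_conj (g h : G) : g = 1 ∨ h = 1 ∨ ∃ s, s * g * s⁻¹ = h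

namespace EnumeratedTorsionFreeGroup

/-- The degenerate alternative is an open condition too, so the union is open; an extension is
needed only where that alternative fails. The next two results have the same pattern. -/
theorem setOf_exists_centralizing_mem_residual (f k : ℕ) :
    {t | elem k t ∈ Subgroup.zpowers (elem f t) ∨
      ∃ s, Commute s (elem f t) ∧ ¬ Commute (s ^ 12) (elem k t)} ∈
      residual EnumeratedTorsionFreeGroup := by
  refine mem_residual_of_extension ?_ {f, k} fun t ht => ?_
  · refine (IsContinuousFamily.isOpen_setOf_mem_zpowers (.elem f) (.elem k)).union
      (isOpen_setOf_exists fun s => ?_)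
    exact (IsContinuousFamily.isOpen_setOf_commute (.elem s) (.elem f)).inter
      ((((IsContinuousFamily.elem s).pow 12).mul (.elem k)).isOpen_setOf_ne
        ((IsContinuousFamily.elem k).mul ((IsContinuousFamily.elem s).pow 12)))
  · rw [Set.mem_ofPred_eq, not_or] at ht
    obtain ⟨K, iK, cK, ι, hK, hι, s, hs, hs'⟩ :=
      exists_extension_centralizing t.2 ht.1 (m := 12) (by norm_num)
    refine ⟨K, iK, cK, ι, hK, hι, fun t' e he => Or.inr ⟨e.symm s, ?_, ?_⟩⟩
    · rw [← commute_map_iff e.injective, e.apply_symm_apply, he f (by simp)]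
      exact hs
    · rw [← commute_map_iff e.injective, map_pow, e.apply_symm_apply, he k (by simp)]
      exact hs'

theorem setOf_exists_commutator_mem_residual (g h : ℕ) :
    {t | elem h t ∈ Subgroup.zpowers (elem g t) ∨
      ∃ a b, Commute a (elem g t) ∧ Commute b (elem g t) ∧ ⁅a, ⁅b, elem h t⁆⁆ ≠ 1 ∧
        Commute (elem g t) ⁅a, ⁅b, elem h t⁆⁆} ∈ residual EnumeratedTorsionFreeGroup := by
  refine mem_residual_of_extension ?_ {g, h} fun t ht => ?_
  · refine (IsContinuousFamily.isOpen_setOf_mem_zpowers (.elem g) (.elem h)).union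
      (isOpen_setOf_exists fun a => isOpen_setOf_exists fun b => ?_)
    have hc : IsContinuousFamily fun t => ⁅elem a t, ⁅elem b t, elem h t⁆⁆ :=
      .commutatorElement (.elem a) (.commutatorElement (.elem b) (.elem h))
    exact (IsContinuousFamily.isOpen_setOf_commute (.elem a) (.elem g)).inter
      ((IsContinuousFamily.isOpen_setOf_commute (.elem b) (.elem g)).inter
        ((hc.isOpen_setOf_ne .one).inter
          (IsContinuousFamily.isOpen_setOf_commute (.elem g) hc)))
  · rw [Set.mem_ofPred_eq, not_or] at ht
    obtain ⟨K, iK, cK, ι, hK, hι, a, b, ha, hb, hne, hc⟩ :=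
      exists_extension_commutator t.2 ht.1
    refine ⟨K, iK, cK, ι, hK, hι, fun t' e he => Or.inr ⟨e.symm a, e.symm b, ?_, ?_, ?_, ?_⟩⟩
    · rw [← commute_map_iff e.injective, e.apply_symm_apply, he g (by simp)]
      exact ha
    · rw [← commute_map_iff e.injective, e.apply_symm_apply, he g (by simp)]
      exact hb
    · rw [Ne, ← map_eq_one_iff e e.injective, map_commutatorElement, map_commutatorElement,
        e.apply_symm_apply, e.apply_symm_apply, he h (by simp)]
      exact hne
    · rw [← commute_map_iff e.injective, map_commutatorElement, map_commutatorElement,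
        e.apply_symm_apply, e.apply_symm_apply, he h (by simp), he g (by simp)]
      exact hc

theorem setOf_exists_conj_mem_residual (g h : ℕ) :
    {t | elem g t = 1 ∨ elem h t = 1 ∨ ∃ s, s * elem g t * s⁻¹ = elem h t} ∈
      residual EnumeratedTorsionFreeGroup := by
  refine mem_residual_of_extension ?_ {g, h} fun t ht => ?_
  · refine (IsContinuousFamily.isOpen_setOf_eq (.elem g) .one).union
      ((IsContinuousFamily.isOpen_setOf_eq (.elem h) .one).union
        (isOpen_setOf_exists fun s => ?_))
    exact (((IsContinuousFamily.elem s).mul (.elem g)).mul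
      (IsContinuousFamily.elem s).inv).isOpen_setOf_eq (.elem h)
  · rw [Set.mem_ofPred_eq, not_or, not_or] at ht
    obtain ⟨K, iK, cK, ι, hK, hι, s, hs⟩ := exists_extension_conj t.2 ht.1 ht.2.1
    refine ⟨K, iK, cK, ι, hK, hι, fun t' e he => Or.inr (Or.inr ⟨e.symm s, e.injective ?_⟩)⟩
    rw [map_mul, map_mul, map_inv, e.apply_symm_apply, he g (by simp), he h (by simp)]
    exact hs

theorem setOf_isGenericTorsionFree_mem_residual :
    {t : EnumeratedTorsionFreeGroup | IsGenericTorsionFree t.toGroup} ∈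
      residual EnumeratedTorsionFreeGroup := by
  filter_upwards [eventually_countable_forall.2 fun f => eventually_countable_forall.2 fun k =>
      setOf_exists_centralizing_mem_residual f k,
    eventually_countable_forall.2 fun f => eventually_countable_forall.2 fun k =>
      setOf_exists_commutator_mem_residual f k,
    eventually_countable_forall.2 fun f => eventually_countable_forall.2 fun k =>
      setOf_exists_conj_mem_residual f k] with t h1 h2 h3
  exact ⟨t.2, h1, h2, h3⟩

end EnumeratedTorsionFreeGroup

/-! ### Algebraic disjointness and the Rubin poset of a generic group -/

theorem HasNoTorsion.zpow_mem_zpowers_zpow_iff {G : Type*} [Group G] (h : HasNoTorsion G) {g : G}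
    (hg : g ≠ 1) {m n : ℤ} : g ^ m ∈ Subgroup.zpowers (g ^ n) ↔ n ∣ m := by
  constructor
  · rintro ⟨k, hk⟩
    have hk' : (g ^ n) ^ k = g ^ m := hk
    rw [← zpow_mul, ← mul_inv_eq_one, ← zpow_neg, ← zpow_add, h.zpow_eq_one_iff hg] at hk'
    exact ⟨k, by linarith⟩
  · rintro ⟨k, rfl⟩
    exact ⟨k, (zpow_mul g n k).symm⟩

namespace IsGenericTorsionFree

variable {G : Type*} [Group G]

theorem isSimpleGroup [Nontrivial G] (hG : IsGenericTorsionFree G) : IsSimpleGroup G where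
  eq_bot_or_eq_top_of_normal N hN := by
    refine or_iff_not_imp_left.2 fun hbot => ?_
    obtain ⟨⟨g, hg⟩, hg1⟩ := Subgroup.ne_bot_iff_exists_ne_one.1 hbot
    refine (Subgroup.eq_top_iff' N).2 fun h => ?_
    rcases hG.exists_conj g h with rfl | rfl | ⟨s, rfl⟩
    · exact absurd rfl hg1
    · exact N.one_mem
    · exact hN.conj_mem g hg s

/-- If `s` conjugates `g ^ 2` to `g`, it conjugates `g` to a square root of `g`. -/
theorem exists_sq_eq (hG : IsGenericTorsionFree G) (g : G) : ∃ r, r ^ 2 = g := by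
  rcases hG.exists_conj (g ^ 2) g with h | rfl | ⟨s, hs⟩
  · exact ⟨1, by rw [one_pow, hG.hasNoTorsion.eq_one one_le_two h]⟩
  · exact ⟨1, one_pow 2⟩
  · exact ⟨s * g * s⁻¹, by rw [conj_pow, hs]⟩

/-- If `f` and `g` do not commute, `h = g` violates disjointness, since every `b` centralizing `g`
has `⁅b, g⁆ = 1`. If they commute, any `h` with `⁅f, h⁆ ≠ 1` lies outside `⟨g⟩`, and
`exists_commutator` applies. -/
theorem algebraicallyDisjointFrom_iff_commute (hG : IsGenericTorsionFree G) {f g : G} :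
    AlgebraicallyDisjointFrom g f ↔ Commute f g := by
  constructor
  · intro h
    by_contra hfg
    obtain ⟨a, -, b, hb, hne, -⟩ := h g (by rwa [Ne, commutatorElement_eq_one_iff_commute])
    rw [Subgroup.mem_centralizer_singleton_iff] at hb
    rw [commutatorElement_eq_one_iff_mul_comm.2 hb, commutatorElement_one_right] at hne
    exact hne rfl
  · intro hfg h hfh
    rcases hG.exists_commutator g h with ⟨n, rfl⟩ | ⟨a, b, ha, hb, hne, hc⟩
    · exact absurd (commutatorElement_eq_one_iff_commute.2 (hfg.zpow_right n)) hfh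
    · exact ⟨a, Subgroup.mem_centralizer_singleton_iff.2 ha, b,
        Subgroup.mem_centralizer_singleton_iff.2 hb, hne,
        Subgroup.mem_centralizer_singleton_iff.2 hc.symm⟩

theorem centralizer_disjointTwelfthPowers (hG : IsGenericTorsionFree G) (f : G) :
    Subgroup.centralizer (disjointTwelfthPowers f) = Subgroup.zpowers f := by
  ext k
  rw [Subgroup.mem_centralizer_iff]
  constructor
  · intro hk
    rcases hG.exists_centralizing f k with h | ⟨s, hs, hs'⟩
    · exact h
    · exact absurd (hk _ ⟨s, hG.algebraicallyDisjointFrom_iff_commute.2 hs.symm, rfl⟩) hs'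
  · rintro ⟨n, rfl⟩ _ ⟨g, hg, rfl⟩
    exact ((hG.algebraicallyDisjointFrom_iff_commute.1 hg).symm.pow_left 12).zpow_right n

theorem rubinPoset_eq (hG : IsGenericTorsionFree G) :
    rubinPoset G = {H : Subgroup G | IsCyclic H} := by
  ext H
  simp only [rubinPoset, hG.centralizer_disjointTwelfthPowers, Set.mem_ofPred_eq]
  constructor
  · rintro ⟨n, hn, f, rfl⟩
    exact Subgroup.isCyclic_of_le (iInf_le (fun i => Subgroup.zpowers (f i)) ⟨0, hn⟩)
  · intro hH
    obtain ⟨g, rfl⟩ := (Subgroup.isCyclic_iff_exists_zpowers_eq_top H).1 hH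
    exact ⟨1, le_rfl, fun _ => g, iInf_const.symm⟩

theorem zpowers_mem_rubinPoset (hG : IsGenericTorsionFree G) (g : G) :
    Subgroup.zpowers g ∈ rubinPoset G := by
  rw [hG.rubinPoset_eq]
  exact Subgroup.isCyclic_zpowers g

theorem exists_strictMono [Nontrivial G] (hG : IsGenericTorsionFree G) :
    ∃ c : ℤ → rubinPoset G, StrictMono c := by
  obtain ⟨f, hf⟩ := exists_ne (1 : G)
  choose r hr using hG.exists_sq_eq
  -- Iterated square roots of `f` upwards and iterated squares downwards, so that `u (z + 1) ^ 2 = u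
  -- z` throughout. Note that `.negSucc n` is the index `-(n + 1)`.
  let u : ℤ → G
    | .ofNat n => r^[n] f
    | .negSucc n => f ^ 2 ^ (n + 1)
  have hu : ∀ z, u (z + 1) ^ 2 = u z
    | .ofNat n => by
      change (r^[n + 1] f) ^ 2 = r^[n] f
      rw [Function.iterate_succ_apply', hr]
    | .negSucc 0 => rfl
    | .negSucc (n + 1) => by
      change (f ^ 2 ^ (n + 1)) ^ 2 = f ^ 2 ^ (n + 1 + 1)
      rw [← pow_mul, ← pow_succ]
  have hne : ∀ z, u z ≠ 1
    | .ofNat n => by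
      induction n with
      | zero => exact hf
      | succ n ih =>
        intro h
        exact ih ((hu (.ofNat n)).symm.trans ((congrArg (· ^ 2) h).trans (one_pow 2)))
    | .negSucc n => hG.hasNoTorsion f hf _ Nat.one_le_two_pow
  refine ⟨fun z => ⟨Subgroup.zpowers (u z), hG.zpowers_mem_rubinPoset _⟩,
    strictMono_int_of_lt_succ fun z => ?_⟩
  change Subgroup.zpowers (u z) < Subgroup.zpowers (u (z + 1))
  rw [← hu z, SetLike.lt_iff_le_and_exists, Subgroup.zpowers_le]
  refine ⟨Subgroup.npow_mem_zpowers _ 2, _, Subgroup.mem_zpowers _, fun h => ?_⟩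
  have h2 : u (z + 1) ^ (1 : ℤ) ∈ Subgroup.zpowers (u (z + 1) ^ (2 : ℤ)) := by
    simpa using h
  rw [hG.hasNoTorsion.zpow_mem_zpowers_zpow_iff (hne _)] at h2
  omega

/-- Inclusion among the subgroups `⟨f ^ p⟩` is reversed divisibility, and distinct primes do not
divide one another. -/
theorem exists_infinite_isAntichain [Nontrivial G] (hG : IsGenericTorsionFree G) :
    ∃ A : Set (rubinPoset G), A.Infinite ∧ IsAntichain (· ≤ ·) A := by
  obtain ⟨f, hf⟩ := exists_ne (1 : G)
  let c : Nat.Primes → rubinPoset G :=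
    fun p => ⟨Subgroup.zpowers (f ^ ((p : ℕ) : ℤ)), hG.zpowers_mem_rubinPoset _⟩
  have hc : ∀ p q, c p ≤ c q → p = q := by
    intro p q h
    have h' : Subgroup.zpowers (f ^ ((p : ℕ) : ℤ)) ≤ Subgroup.zpowers (f ^ ((q : ℕ) : ℤ)) := h
    rw [Subgroup.zpowers_le, hG.hasNoTorsion.zpow_mem_zpowers_zpow_iff hf,
      Int.natCast_dvd_natCast, Nat.prime_dvd_prime_iff_eq q.2 p.2] at h'
    exact Subtype.ext h'.symm
  refine ⟨Set.range c, Set.infinite_range_of_injective fun p q h => hc p q h.le, ?_⟩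
  rintro _ ⟨p, rfl⟩ _ ⟨q, rfl⟩ hne h
  exact hne (congrArg c (hc p q h))

end IsGenericTorsionFree

/-! ### Locally moving actions -/

section

variable {G X : Type*} [Group G] [MulAction G X]

/-- The support of `⁅a, ⁅b, h⁆⁆` is covered by four translates of any set that contains the
support of `h`. -/
theorem exists_smul_mem_of_commutator_smul_ne {U : Set X} {a b h : G}
    (hU : ∀ x, x ∉ U → h • x = x) {y : X} (hy : ⁅a, ⁅b, h⁆⁆ • y ≠ y) :
    ∃ j : Fin 4, (![1, b⁻¹, a⁻¹, b⁻¹ * a⁻¹] j : G) • y ∈ U := by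
  have hU' : ∀ x, x ∉ U → h⁻¹ • x = x := fun x hx => by rw [inv_smul_eq_iff, hU x hx]
  have hw : ∀ x, x ∉ U → b⁻¹ • x ∉ U → ⁅b, h⁆⁻¹ • x = x := by
    intro x hx hbx
    rw [commutatorElement_inv, commutatorElement_def, mul_smul, mul_smul, mul_smul, hU' _ hbx,
      smul_inv_smul, hU x hx]
  by_contra! hj
  have h0 : y ∉ U := by simpa using hj 0
  have h1 : b⁻¹ • y ∉ U := by simpa using hj 1
  have h2 : a⁻¹ • y ∉ U := by simpa using hj 2
  have h3 : b⁻¹ • a⁻¹ • y ∉ U := by simpa [mul_smul] using hj 3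
  refine hy ?_
  rw [commutatorElement_def, mul_smul, mul_smul, mul_smul, hw y h0 h1,
    ← inv_smul_eq_iff.1 (hw _ h2 h3), smul_inv_smul]

/-- An element whose first `n` powers move `U` off itself is not centralized by an element whose
support is covered by `n` translates of `U` by elements that commute with it. -/
theorem exists_smul_eq_of_commute {U : Set X} {g k : G} {n : ℕ}
    (hg : ∀ i, 1 ≤ i → i ≤ n → ∀ x ∈ U, g ^ i • x ∉ U) {c : Fin n → G}
    (hc : ∀ j, Commute g (c j)) (hk : Commute g k)
    (hkc : ∀ y, k • y ≠ y → ∃ j, c j • y ∈ U) (x : X) : k • x = x := by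
  by_contra hx
  have hmoved (i : ℕ) : k • g ^ i • x ≠ g ^ i • x := by
    rw [← mul_smul, ← (hk.pow_left i).eq, mul_smul]
    exact fun h => hx (smul_left_cancel _ h)
  choose d hd using fun i : Fin (n + 1) => hkc _ (hmoved i)
  -- The `n + 1` points `g ^ i • x` are all moved by `k`. Two of them cannot use the same `c j`:
  -- their images in `U` would differ by a power `g ^ (i' - i)`, which moves `U` off itself.
  have key (i i' : Fin (n + 1)) (hlt : i < i') (h : d i = d i') : False := by
    refine hg (i' - i) (by omega) (by omega) _ (hd i) ?_
    have hd' := hd i'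
    rw [← h] at hd'
    rwa [← mul_smul, ((hc (d i)).pow_left _).eq, mul_smul, ← mul_smul (g ^ _), ← pow_add,
      Nat.sub_add_cancel (le_of_lt hlt)]
  obtain ⟨i, i', hne, h⟩ := Fintype.exists_ne_map_eq_of_card_lt d (by simp)
  rcases lt_or_gt_of_ne hne with hlt | hlt
  · exact key i i' hlt h
  · exact key i' i hlt h.symm

theorem exists_isOpen_pow_smul_notMem [TopologicalSpace X] [T2Space X] [ContinuousConstSMul G X]
    {g : G} {p : X} {n : ℕ} (hp : ∀ i, 1 ≤ i → i ≤ n → g ^ i • p ≠ p) :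
    ∃ U : Set X, IsOpen U ∧ p ∈ U ∧ ∀ i, 1 ≤ i → i ≤ n → ∀ x ∈ U, g ^ i • x ∉ U := by
  have h (i : ℕ) : ∃ U : Set X, IsOpen U ∧ p ∈ U ∧ (1 ≤ i → i ≤ n → ∀ x ∈ U, g ^ i • x ∉ U) := by
    by_cases hi : 1 ≤ i ∧ i ≤ n
    · obtain ⟨V, W, hV, hW, hpV, hpW, hVW⟩ := t2_separation (hp i hi.1 hi.2).symm
      refine ⟨V ∩ (g ^ i • ·) ⁻¹' W, hV.inter (hW.preimage (continuous_const_smul _)),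
        ⟨hpV, hpW⟩, fun _ _ x hx hx' => ?_⟩
      exact Set.disjoint_left.1 hVW hx'.1 hx.2
    · exact ⟨Set.univ, isOpen_univ, trivial, fun h1 h2 => absurd ⟨h1, h2⟩ hi⟩
  choose U hU hpU hgU using h
  refine ⟨⋂ i ∈ Finset.Icc 1 n, U i, isOpen_biInter_finset fun i _ => hU i,
    Set.mem_iInter₂.2 fun i _ => hpU i, fun i h1 h2 x hx hx' => ?_⟩
  have hi : i ∈ Finset.Icc 1 n := Finset.mem_Icc.2 ⟨h1, h2⟩
  exact hgU i h1 h2 x (Set.mem_iInter₂.1 hx i hi) (Set.mem_iInter₂.1 hx' i hi)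

end

theorem exists_apply_ne_of_ne_one {X : Type*} [TopologicalSpace X] {γ : X ≃ₜ X} (h : γ ≠ 1) :
    ∃ x, γ x ≠ x := by
  by_contra! h'
  exact h (Homeomorph.ext h')

theorem IsLocallyMoving.ne_bot {X : Type*} [TopologicalSpace X] [Nonempty X]
    {Γ : Subgroup (X ≃ₜ X)} (h : IsLocallyMoving Γ) : Γ ≠ ⊥ := by
  rintro rfl
  refine h Set.univ isOpen_univ Set.univ_nonempty ((Subgroup.eq_bot_iff_forall _).2 ?_)
  rintro γ ⟨hγ, -⟩
  exact hγ

/-- Under a trivial rigid stabilizer the orbit of `p` is the closed set `{p}`, which has empty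
interior. -/
theorem IsLocallyDense.isLocallyMoving {X : Type*} [TopologicalSpace X] [T1Space X]
    (hX : ∀ x : X, ¬ IsOpen ({x} : Set X)) {Γ : Subgroup (X ≃ₜ X)} (h : IsLocallyDense Γ) :
    IsLocallyMoving Γ := by
  rintro U hU ⟨p, hp⟩ hbot
  have horbit : {q : X | ∃ γ ∈ rigidStabilizer Γ U, γ p = q} = {p} := by
    ext q
    simp [hbot, eq_comm]
  have hne := h U hU p hp
  rw [horbit, closure_singleton] at hne
  rcases Set.subset_singleton_iff_eq.1 (interior_subset (s := ({p} : Set X))) with h0 | h1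
  · exact hne.ne_empty h0
  · exact hX p (h1 ▸ isOpen_interior)

theorem IsRubinGroup.isWeaklyRubinGroup.{w, v} {Q : Type v} [Group Q]
    (h : IsRubinGroup.{w, v} Q) : IsWeaklyRubinGroup.{w, v} Q := by
  obtain ⟨X, _, ⟨x⟩, _, -, hX, φ, -, hφ⟩ := h
  refine ⟨X, inferInstance, ?_, inferInstance, φ, hφ.isLocallyMoving hX⟩
  by_contra hnt
  rw [not_nontrivial_iff_subsingleton] at hnt
  exact hX x (isOpen_discrete _)

namespace IsGenericTorsionFree

variable {G : Type*} [Group G]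

theorem not_isLocallyMoving_range_of_injective [Nontrivial G] (hG : IsGenericTorsionFree G)
    {X : Type*} [TopologicalSpace X] [T2Space X] {φ : G →* (X ≃ₜ X)}
    (hφ : Function.Injective φ) : ¬ IsLocallyMoving φ.range := by
  intro hmov
  let _ : MulAction G X :=
    { smul := fun g x => φ g x
      one_smul := fun x => by change φ 1 x = x; rw [map_one]; rfl
      mul_smul := fun g h x => by change φ (g * h) x = φ g (φ h x); rw [map_mul]; rfl }
  have hcont : ContinuousConstSMul G X := ⟨fun g => (φ g).continuous⟩
  have hmoved (k : G) (hk : k ≠ 1) : ∃ x : X, k • x ≠ x :=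
    exists_apply_ne_of_ne_one fun h => hk (hφ (h.trans (map_one φ).symm))
  obtain ⟨g, hg⟩ := exists_ne (1 : G)
  -- Since 12 is the least common multiple of 1, 2, 3, 4, a point moved by `g ^ 12` is moved by `g,
  -- ..., g ^ 4`.
  obtain ⟨p, hp⟩ := hmoved _ (hG.hasNoTorsion g hg 12 (by norm_num))
  have hpow (i : ℕ) (h1 : 1 ≤ i) (h4 : i ≤ 4) : g ^ i • p ≠ p := by
    intro hi
    have hdvd : i ∣ 12 := by interval_cases i <;> norm_num
    obtain ⟨m, hm⟩ := hdvd
    refine hp ?_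
    rw [hm, pow_mul]
    exact (MulAction.stabilizer G p).pow_mem hi m
  obtain ⟨U, hU, hpU, hgU⟩ := exists_isOpen_pow_smul_notMem hpow
  obtain ⟨⟨_, ⟨h, rfl⟩, hh⟩, hne⟩ := Subgroup.ne_bot_iff_exists_ne_one.1 (hmov U hU ⟨p, hpU⟩)
  have hh' : ∀ x, x ∉ U → h • x = x := hh
  obtain ⟨x, hx⟩ : ∃ x : X, h • x ≠ x :=
    exists_apply_ne_of_ne_one fun h1 => hne (Subtype.ext h1)
  have hxU : x ∈ U := by_contra fun h1 => hx (hh' x h1)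
  rcases hG.exists_commutator g h with ⟨n, rfl⟩ | ⟨a, b, ha, hb, hk, hgk⟩
  -- A power of `g` commutes with `g`; fixing `g • x`, which lies outside `U`, it would also fix
  -- `x`.
  · have h1 := hh' (g • x) (by simpa using hgU 1 le_rfl (by norm_num) x hxU)
    rw [← mul_smul, ← ((Commute.refl g).zpow_right n).eq, mul_smul] at h1
    exact hx (smul_left_cancel _ h1)
  · obtain ⟨y, hy⟩ := hmoved _ hk
    refine hy (exists_smul_eq_of_commute hgU (c := ![1, b⁻¹, a⁻¹, b⁻¹ * a⁻¹]) ?_ hgk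
      (fun z hz => exists_smul_mem_of_commutator_smul_ne hh' hz) y)
    intro j
    fin_cases j
    · exact Commute.one_right g
    · exact hb.symm.inv_right
    · exact ha.symm.inv_right
    · exact hb.symm.inv_right.mul_right ha.symm.inv_right

theorem not_isLocallyMoving_range [Nontrivial G] (hG : IsGenericTorsionFree G)
    {X : Type*} [TopologicalSpace X] [T2Space X] {φ : G →* (X ≃ₜ X)} (hφ : φ ≠ 1) :
    ¬ IsLocallyMoving φ.range := by
  have := hG.isSimpleGroup
  refine hG.not_isLocallyMoving_range_of_injective ((MonoidHom.ker_eq_bot_iff φ).1 ?_)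
  refine (this.eq_bot_or_eq_top_of_normal φ.ker inferInstance).resolve_right fun h => hφ ?_
  exact MonoidHom.ker_eq_top_iff.1 h

/-- Composing with the projection from `G` keeps the image, and a locally moving image is
nontrivial. -/
theorem not_isWeaklyRubinGroup_quotient.{w, v} {G : Type v} [Group G] [Nontrivial G]
    (hG : IsGenericTorsionFree G) (N : Subgroup G) [N.Normal] :
    ¬ IsWeaklyRubinGroup.{w, v} (G ⧸ N) := by
  rintro ⟨X, _, _, _, φ, hφ⟩
  have hrange : (φ.comp (QuotientGroup.mk' N)).range = φ.range := by
    rw [MonoidHom.range_comp, MonoidHom.range_eq_top.2 (QuotientGroup.mk'_surjective N),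
      MonoidHom.range_eq_map]
  refine hG.not_isLocallyMoving_range (φ := φ.comp (QuotientGroup.mk' N)) (fun h => ?_)
    (hrange ▸ hφ)
  rw [h, MonoidHom.range_one] at hrange
  exact hφ.ne_bot hrange.symm

end IsGenericTorsionFree

theorem theorem1p2 :
    ∃ 𝒳 : Set EnumeratedTorsionFreeGroup, 𝒳 ∈ residual EnumeratedTorsionFreeGroup ∧
      ∀ t ∈ 𝒳,
        -- (1) no quotient is a Rubin group or a weakly Rubin group
        ((∀ (N : Subgroup t.toGroup) [N.Normal],
            ¬ IsRubinGroup.{u, 0} (t.toGroup ⧸ N) ∧ ¬ IsWeaklyRubinGroup.{u, 0} (t.toGroup ⧸ N)) ∧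
          (∀ (X : Type u) [TopologicalSpace X] [T2Space X] (φ : t.toGroup →* (X ≃ₜ X)),
            φ ≠ 1 → ¬ IsLocallyMoving φ.range)) ∧
        -- (2) the Rubin poset consists of the cyclic subgroups and is rich
        (rubinPoset t.toGroup = {H : Subgroup t.toGroup | IsCyclic H} ∧
          (∃ c : ℤ → rubinPoset t.toGroup, StrictMono c) ∧
          (∃ A : Set (rubinPoset t.toGroup), A.Infinite ∧ IsAntichain (· ≤ ·) A)) ∧
        -- (3) commutation is algebraic disjointness
        (∀ f g : t.toGroup, f ≠ 1 → g ≠ 1 →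
          (Commute f g ↔ AlgebraicallyDisjointFrom g f)) := by
  refine ⟨_, EnumeratedTorsionFreeGroup.setOf_isGenericTorsionFree_mem_residual, fun t ht => ?_⟩
  have hG : IsGenericTorsionFree t.toGroup := ht
  have hN (N : Subgroup t.toGroup) [N.Normal] := hG.not_isWeaklyRubinGroup_quotient.{u, 0} N
  exact ⟨⟨fun N _ => ⟨fun h => hN N h.isWeaklyRubinGroup, hN N⟩,
      fun X _ _ φ hφ => hG.not_isLocallyMoving_range hφ⟩,
    ⟨hG.rubinPoset_eq, hG.exists_strictMono, hG.exists_infinite_isAntichain⟩,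
    fun f g _ _ => hG.algebraicallyDisjointFrom_iff_commute.symm⟩
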